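/- Theorem (optimal randomized mechanisms are not false-name-proof). A seller offers two items to one additive buyer whose values $v=(v_1,v_2)$ are drawn IID from the finite-support (Hart–Reny) distribution $F$ on $\{10,13,46,47,80,100\}$ with $$F(10)=\tfrac{2399}{9000},\quad F(13)=\tfrac{1}{9000},\quad F(46)=\tfrac{1}{90},\quad F(47)=\tfrac13,\quad F(80)=\tfrac{7}{30},\quad F(100)=\tfrac{7}{45}.$$ A (randomized) menu is a possibly infinite set $M$ of entries $(\pi,p)$ with $\pi\in[0,1]^2$ and $p\in\mathbb R$: for the payment $p$, item $i$ is received with probability $\pi_i$. A buyer who picks a finite multiset $B$ of entries, $B=\{(\pi^1,p^1),\dots,(\pi^k,p^k)\}$ with $k\ge 0$, plays the lotteries independently, so that she receives item $i$ with probability $1-\prod_{j}(1-\pi^j_i)$, pays $\sum_j p^j$, and has utility $$\sum_{i=1}^2 v_i\Big(1-\prod_{j=1}^k(1-\pi^j_i)\Big)-\sum_{j=1}^k p^j .$$ She picks an allowed multiset of maximal utility, breaking ties in favor of a higher payment; only menus for which every $v$ in the support of $F\times F$ has such a choice are considered, and the revenue of such a menu is the expected payment under $F\times F$. Consider two models: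 (1) at most one entry may be picked ($k\le 1$); (2) the non-adaptive probabilistic buyer: any finite number of entries may be picked, with repetition, before the outcome of any lottery is observed. Then in each of the two models the supremum $R_1$, respectively $R_2$, of the revenue over all such menus is finite and attained; $R_1$ is attained by a menu with finitely many entries; and $R_2<R_1$. -/

import Mathlib

open scoped ENNReal

noncomputable section

namespace FalseName

/-- A valuation of an additive buyer for two items: the value of each item. -/
abbrev Valuation : Type := Fin 2 → ℝ

/-- A menu entry: item `i` is allocated with probability `alloc i`, for the payment `price`. -/
structure Entry where
  alloc : Fin 2 → ℝ
  price : ℝ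
  alloc_mem : ∀ i, alloc i ∈ Set.Icc (0 : ℝ) 1

/-- A menu of lotteries. It may be infinite; the buyer may always take nothing. -/
abbrev Menu : Type := Set Entry

/-- The probability of receiving item `i` when the entries of `B` (with multiplicity) are
independent lotteries; for two entries this is `1 - (1 - π i) * (1 - ρ i)`. -/
def winProb (B : Multiset Entry) (i : Fin 2) : ℝ :=
  1 - (B.map fun e => 1 - e.alloc i).prod

/-- The total payment for the entries of `B`. -/
def payment (B : Multiset Entry) : ℝ := (B.map fun e => e.price).sum

/-- The expected quasi-linear utility of a buyer with valuation `v` who picks the entries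
of `B`. -/
def utility (v : Valuation) (B : Multiset Entry) : ℝ :=
  (∑ i, v i * winProb B i) - payment B

/-- A buyer model says which collections of entries may be picked from a menu. -/
abbrev BuyerModel : Type := Menu → Set (Multiset Entry)

/-- The buyer picks one entry of the menu, or nothing. -/
def singlePick : BuyerModel := fun M => {B | Multiset.card B ≤ 1 ∧ ∀ e ∈ B, e ∈ M}

/-- The non-adaptive probabilistic buyer: before any lottery is drawn she picks finitely many
entries of the menu, possibly the same entry several times, possibly none. -/
def nonAdaptivePicks : BuyerModel := fun M => {B | ∀ e ∈ B, e ∈ M}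

/-- `B` maximizes the utility of a buyer with valuation `v` over the collections in `A`, ties
being broken in favor of higher payments. -/
def IsBuyerChoice (A : Set (Multiset Entry)) (v : Valuation) (B : Multiset Entry) : Prop :=
  B ∈ A ∧ (∀ B' ∈ A, utility v B' ≤ utility v B) ∧
    ∀ B' ∈ A, utility v B' = utility v B → payment B' ≤ payment B

/-- The menu `M` has expected revenue `r` for valuations drawn from the (discrete)
distribution `D`; in particular every buyer type in the support has a choice. -/
def HasRevenue (D : PMF Valuation) (model : BuyerModel) (M : Menu) (r : ℝ) : Prop :=
  ∃ choice : Valuation → Multiset Entry,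
    (∀ v ∈ D.support, IsBuyerChoice (model M) v (choice v)) ∧
      r = ∑' v, (D v).toReal * payment (choice v)

/-- `r` is the optimal expected revenue: it is attained by some menu and no menu has more. -/
def IsOptimalRevenue (D : PMF Valuation) (model : BuyerModel) (r : ℝ) : Prop :=
  IsGreatest {x | ∃ M : Menu, HasRevenue D model M x} r

/-- Two items whose values are sampled IID from `F`. -/
def iidPair (F : PMF ℝ) : PMF Valuation :=
  F.bind fun a => F.bind fun b => PMF.pure ![a, b]

/-- The point masses of the Hart–Reny distribution. -/
def hartRenyMass (x : ℝ) : ℝ≥0∞ :=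
  ENNReal.ofReal
    (if x = 10 then 2399 / 9000
    else if x = 13 then 1 / 9000
    else if x = 46 then 1 / 90
    else if x = 47 then 1 / 3
    else if x = 80 then 7 / 30
    else if x = 100 then 7 / 45
    else 0)

theorem hartRenyMass_sum :
    ∑ x ∈ ({10, 13, 46, 47, 80, 100} : Finset ℝ), hartRenyMass x = 1 := by
  unfold hartRenyMass
  rw [← ENNReal.ofReal_sum_of_nonneg (fun x _ => by split_ifs <;> norm_num),
    ← ENNReal.ofReal_one]
  congr 1
  repeat rw [Finset.sum_insert (by norm_num)]
  rw [Finset.sum_singleton]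
  norm_num

theorem hartRenyMass_eq_zero (x : ℝ) (hx : x ∉ ({10, 13, 46, 47, 80, 100} : Finset ℝ)) :
    hartRenyMass x = 0 := by
  simp only [Finset.mem_insert, Finset.mem_singleton, not_or] at hx
  simp [hartRenyMass, hx]

/-- The Hart–Reny distribution. -/
def hartReny : PMF ℝ :=
  PMF.ofFinset hartRenyMass {10, 13, 46, 47, 80, 100} hartRenyMass_sum hartRenyMass_eq_zero

end FalseName

end

open scoped ENNReal

noncomputable section

namespace FalseName

/-! Averaging a buyer's choices over the exchange of the items turns any menu, in either model, into
a symmetric direct mechanism of the same revenue. Its revenue is bounded by a linear program over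
the 6 × 6 types, and weak duality with explicit rational multipliers gives `revenue_le`. A menu with
eleven entries of common denominator 65285 meets this bound, so R₁ = `optimalRevenue` ≈ 69.4713.

In that menu the type (47, 47) buys a cheap lottery winning each item with probability 1925/65285 ≈
0.03, while (47, 80) buys both items for 126 and keeps utility 1. Playing the cheap lottery twice
would give (47, 80) more. Generally, let A be the symmetrized winning probability of (47, 47). If A
≥ 1/20, `revenue_add_le` costs too much revenue. If A ≤ 1/20, the quadratic loss of independent
repetition is small, so doubling forces a linear utility gap between the two types, and
`revenue_le_of_utility_gap` applies. Both bounds lie strictly below R₁.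

That R₂ is attained is a compactness argument: the direct mechanisms immune to multiple reports form
a compact set, contain the outcomes of every menu, and are implemented by the menu of their own
outcomes with no loss of revenue. -/

/-- The values in the support of the Hart–Reny distribution. -/
def value : Fin 6 → ℝ := ![10, 13, 46, 47, 80, 100]

/-- The probabilities of the values in the support of the Hart–Reny distribution. -/
def weight : Fin 6 → ℝ := ![2399 / 9000, 1 / 9000, 1 / 90, 1 / 3, 7 / 30, 7 / 45]

theorem value_zero : value 0 = 10 := rfl
theorem value_one : value 1 = 13 := rfl
theorem value_two : value 2 = 46 := rfl
theorem value_three : value 3 = 47 := rfl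
theorem value_four : value 4 = 80 := rfl
theorem value_five : value 5 = 100 := rfl

theorem weight_zero : weight 0 = 2399 / 9000 := rfl
theorem weight_one : weight 1 = 1 / 9000 := rfl
theorem weight_two : weight 2 = 1 / 90 := rfl
theorem weight_three : weight 3 = 1 / 3 := rfl
theorem weight_four : weight 4 = 7 / 30 := rfl
theorem weight_five : weight 5 = 7 / 45 := rfl

/-! ### Symmetric mechanisms and three linear programming certificates. -/

/-- A direct mechanism that is invariant under exchanging the items. A buyer with the values
`value i` and `value j` wins the item of value `value i` with probability `A i j`, the other one
with probability `A j i`, and has the utility `U i j`. -/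
structure SymmetricMechanism (A U : Fin 6 → Fin 6 → ℝ) : Prop where
  lb : ∀ i j, 0 ≤ A i j
  ub : ∀ i j, A i j ≤ 1
  ir : ∀ i j, 0 ≤ U i j
  symm : ∀ i j, U i j = U j i
  ic : ∀ i j k l,
    U k l + (value i - value k) * A k l + (value j - value l) * A l k ≤ U i j

/-- The revenue of a symmetric direct mechanism. -/
def symmetricRevenue (A U : Fin 6 → Fin 6 → ℝ) : ℝ :=
  ∑ i, ∑ j, weight i * weight j * (value i * A i j + value j * A j i - U i j)

theorem sum_fin_six (f : Fin 6 → ℝ) :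
    ∑ i, f i = f 0 + f 1 + f 2 + f 3 + f 4 + f 5 := by
  rw [Fin.sum_univ_six]

/-- The optimal revenue when a single menu entry may be picked. -/
def optimalRevenue : ℝ := 30614162731 / 440673750

/-- Weak duality: the coefficients are a feasible dual solution, one multiplier per incentive,
participation or probability constraint. Constraints with multiplier zero are not listed. -/
theorem SymmetricMechanism.revenue_le {A U : Fin 6 → Fin 6 → ℝ} (h : SymmetricMechanism A U) :
    symmetricRevenue A U ≤ optimalRevenue := by
  simp only [optimalRevenue, symmetricRevenue, sum_fin_six, weight_zero, weight_one, weight_two,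
    weight_three, weight_four, weight_five]
  have h1 := h.ic 0 4 1 4
  have h2 := h.ic 2 3 0 1
  have h3 := h.ic 2 3 2 2
  have h4 := h.ic 3 5 3 4
  have h5 := h.ic 4 4 4 5
  have h6 := h.ic 4 5 2 5
  have h7 := h.ic 2 3 1 2
  have h8 := h.ic 2 3 0 2
  have h9 := h.ic 2 5 1 5
  have h10 := h.ic 0 4 0 2
  have h11 := h.ic 2 3 0 0
  have h12 := h.ic 4 5 4 4
  have h13 := h.ic 2 4 2 3
  have h14 := h.ic 2 2 3 1
  have h15 := h.ic 1 4 2 3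
  have h16 := h.ic 3 5 2 5
  have h17 := h.ic 3 4 3 5
  have h18 := h.ic 4 5 3 5
  have h19 := h.ic 0 4 3 0
  have h20 := h.ic 3 4 2 4
  have h21 := h.ic 4 5 3 4
  have h22 := h.ic 2 5 2 4
  have h23 := h.ic 5 5 5 4
  have h24 := h.ic 0 5 0 4
  have h25 := h.ic 2 5 0 5
  have h26 := h.ic 2 5 1 4
  have h27 := h.ic 1 5 0 4
  have h28 := h.ic 0 4 2 3
  have h29 := h.ic 0 4 1 3
  have h30 := h.ic 1 3 0 3
  have h31 := h.ic 3 3 3 2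
  have h32 := h.ic 2 5 0 4
  have h33 := h.ic 1 2 1 1
  have h34 := h.ic 2 3 3 0
  have h35 := h.ic 3 5 5 4
  have h36 := h.ic 2 4 3 3
  have h37 := h.ic 2 2 3 0
  have h38 := h.ic 3 4 3 3
  have h39 := h.ic 0 4 0 3
  simp only [value_zero, value_one, value_two, value_three, value_four, value_five,
    h.symm 1 0, h.symm 2 0, h.symm 2 1,
    h.symm 3 0, h.symm 3 1, h.symm 3 2, h.symm 4 0, h.symm 4 1, h.symm 4 2, h.symm 4 3,
    h.symm 5 0, h.symm 5 1, h.symm 5 2, h.symm 5 3, h.symm 5 4]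
    at
      h1 h2 h3 h4 h5 h6 h7 h8 h9 h10 h11 h12 h13 h14 h15 h16 h17 h18 h19 h20 h21 h22 h23 h24 h25
      h26 h27 h28 h29 h30 h31 h32 h33 h34 h35 h36 h37 h38 h39 ⊢
  linear_combination
    833 / 405000 * h1 + 4798 / 21515625 * h.lb 0 1 + 31187 / 1377000000 * h2 + 23 / 2025 * h3 +
    119 / 297 * h4 + 49 / 100 * h5 + 48119837 / 29084467500 * h6 + 59 / 2673000000 * h.ir 1 1 +
    23 / 202500 * h7 + 2399 / 1458000 * h8 + 29096044069841027 / 70875145638000000 * h.ir 2 3 +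
    91 / 6682500 * h9 + 18766341241663 / 38835696240000 * h.ir 0 3 + 1974377 / 247860000 * h10 +
    5755201 / 295650000 * h11 + 155087 / 1336500000 * h.ir 1 2 +
    866411611 / 132202125 * h.ub 4 0 + 98 / 225 * h12 + 68797 / 8902500 * h13 +
    19 / 488700 * h14 + 469 / 202500 * h15 + 55346573 / 538601250 * h16 + 28 / 81 * h.ub 5 2 +
    11548058 / 24481875 * h17 + 658 / 4455 * h18 + 3482845155931 / 247136248800000 * h19 +
    161 / 675 * h20 + 329 / 1485 * h21 + 14 / 675 * h22 + 49 / 2025 * h23 +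
    16793 / 2025 * h.ub 5 0 + 386239 / 3645000 * h24 + 16793 / 729000 * h25 +
    872725088 / 44067375 * h.ub 5 3 + 417386260493 / 14542233750 * h.ub 5 4 +
    392 / 81 * h.ub 5 5 + 178411231 / 1971000000 * h.ir 0 0 + 112753 / 1377000000 * h.ir 0 1 +
    256693 / 16524000 * h.ir 0 2 + 7 / 33750 * h26 + 161 / 3341250 * h27 + 7 / 2025 * h.ub 5 1 +
    669029 / 1322021250 * h28 + 391 / 3665250 * h29 + 161 / 733050 * h30 +
    301 / 81000 * h.lb 1 2 + 383728759 / 881347500 * h31 + 3039924803 / 47592765000 * h32 +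
    13 / 1336500000 * h33 + 36063521537 / 3530517840000 * h34 + 3194462731 / 14542233750 * h35 +
    6856259 / 26707500 * h36 + 466 / 40725 * h37 + 14886178 / 220336875 * h38 +
    20675843 / 19585500 * h.lb 0 4 + 1352569838 / 1454223375 * h.ub 4 5 +
    132631843953436699 / 492048271360800000 * h39

/-- A dual certificate for the objective with a bonus for `A 3 3`. The right side is about 69.506,
so once `A 3 3 ≥ 1 / 20` the revenue is at most about 69.456, below the optimum. -/
theorem SymmetricMechanism.revenue_add_le {A U : Fin 6 → Fin 6 → ℝ}
    (h : SymmetricMechanism A U) :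
    symmetricRevenue A U + A 3 3 ≤ 7225157 / 103950 := by
  simp only [symmetricRevenue, sum_fin_six, weight_zero, weight_one, weight_two, weight_three,
    weight_four, weight_five]
  have h1 := h.ic 2 3 0 0
  have h2 := h.ic 1 3 0 2
  have h3 := h.ic 3 5 3 4
  have h4 := h.ic 4 4 4 5
  have h5 := h.ic 2 3 0 1
  have h6 := h.ic 1 2 1 1
  have h7 := h.ic 2 2 3 1
  have h8 := h.ic 2 3 2 2
  have h9 := h.ic 0 4 0 2
  have h10 := h.ic 2 3 1 2
  have h11 := h.ic 2 3 0 2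
  have h12 := h.ic 0 4 2 3
  have h13 := h.ic 4 5 4 4
  have h14 := h.ic 2 4 2 3
  have h15 := h.ic 0 4 1 3
  have h16 := h.ic 2 4 1 4
  have h17 := h.ic 3 5 2 5
  have h18 := h.ic 3 4 3 5
  have h19 := h.ic 4 5 3 5
  have h20 := h.ic 2 3 3 0
  have h21 := h.ic 3 4 2 4
  have h22 := h.ic 4 5 3 4
  have h23 := h.ic 2 5 2 4
  have h24 := h.ic 5 5 5 4
  have h25 := h.ic 0 5 0 4
  have h26 := h.ic 2 5 0 5
  have h27 := h.ic 1 5 0 4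
  have h28 := h.ic 2 4 0 4
  have h29 := h.ic 3 3 3 2
  have h30 := h.ic 0 5 1 4
  have h31 := h.ic 2 2 3 0
  have h32 := h.ic 2 5 0 4
  have h33 := h.ic 1 4 2 3
  have h34 := h.ic 2 3 0 3
  have h35 := h.ic 3 5 5 4
  have h36 := h.ic 2 4 3 3
  have h37 := h.ic 4 5 2 5
  have h38 := h.ic 3 4 3 3
  have h39 := h.ic 2 5 1 5
  have h40 := h.ic 0 4 0 3
  simp only [value_zero, value_one, value_two, value_three, value_four, value_five,
    h.symm 1 0, h.symm 2 0, h.symm 2 1,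
    h.symm 3 0, h.symm 3 1, h.symm 3 2, h.symm 4 0, h.symm 4 1, h.symm 4 2, h.symm 4 3,
    h.symm 5 0, h.symm 5 1, h.symm 5 2, h.symm 5 3, h.symm 5 4]
    at
      h1 h2 h3 h4 h5 h6 h7 h8 h9 h10 h11 h12 h13 h14 h15 h16 h17 h18 h19 h20 h21 h22 h23 h24 h25
      h26 h27 h28 h29 h30 h31 h32 h33 h34 h35 h36 h37 h38 h39 h40 ⊢
  linear_combination
    5755201 / 295650000 * h1 + 4798 / 21515625 * h.lb 0 1 + 7 / 2025 * h.ub 5 1 +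
    161 / 733050 * h2 + 119 / 297 * h3 + 49 / 100 * h4 + 31187 / 1377000000 * h5 +
    13 / 1336500000 * h6 + 301 / 81000 * h.lb 1 2 + 19 / 488700 * h7 +
    31247586155828857 / 75651903558000000 * h.ir 2 3 + 23 / 2025 * h8 +
    357096587 / 44862660000 * h9 + 23 / 202500 * h10 + 429389 / 263898000 * h11 +
    39833 / 12474000 * h12 + 226091 / 31185 * h.ub 4 0 + 98 / 225 * h13 +
    88043 / 12474000 * h14 + 391 / 3665250 * h15 + 7 / 178200 * h16 + 5099 / 76230 * h17 +
    28 / 81 * h.ub 5 2 + 841 / 1925 * h18 + 658 / 4455 * h19 + 163331201 / 104679540000 * h20 +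
    161 / 675 * h21 + 329 / 1485 * h22 + 14 / 675 * h23 + 49 / 2025 * h24 +
    16793 / 2025 * h.ub 5 0 + 385483 / 3645000 * h25 + 16793 / 729000 * h26 +
    198628 / 10395 * h.ub 5 3 + 98648551 / 3430350 * h.ub 5 4 + 392 / 81 * h.ub 5 5 +
    178411231 / 1971000000 * h.ir 0 0 + 112753 / 1377000000 * h.ir 0 1 +
    47045863 / 2990844000 * h.ir 0 2 + 19918614905201 / 41453097840000 * h.ir 0 3 +
    161 / 3341250 * h27 + 2441 / 462000 * h28 + 59 / 2673000000 * h.ir 1 1 +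
    155087 / 1336500000 * h.ir 1 2 + 24197 / 51975 * h29 + 7 / 33750 * h30 + 466 / 40725 * h31 +
    8213923 / 280665000 * h32 + 133 / 445500 * h33 + 136855134763 / 3768463440000 * h34 +
    757157 / 3430350 * h35 + 397 / 1575 * h36 + 18589 / 6860700 * h37 + 5321 / 51975 * h38 +
    91 / 6682500 * h39 + 311818 / 343035 * h.ub 4 5 + 875652409721 / 3454424820000 * h40

/-- The hypothesis is an additional row of the linear program, with a multiplier of its own. It is
the linearized consequence of doubling, and it lowers the bound to about 69.4455. -/
theorem SymmetricMechanism.revenue_le_of_utility_gap {A U : Fin 6 → Fin 6 → ℝ}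
    (h : SymmetricMechanism A U) (hf : 2 * U 3 3 + 53 * A 3 3 ≤ U 3 4) :
    symmetricRevenue A U ≤ 49474966231 / 712428750 := by
  simp only [symmetricRevenue, sum_fin_six, weight_zero, weight_one, weight_two, weight_three,
    weight_four, weight_five]
  have h1 := h.ic 2 3 0 0
  have h2 := h.ic 2 3 0 1
  have h3 := h.ic 0 4 1 4
  have h4 := h.ic 2 3 2 2
  have h5 := h.ic 3 5 3 4
  have h6 := h.ic 4 4 4 5
  have h7 := h.ic 0 4 0 1
  have h8 := h.ic 1 2 1 1
  have h9 := h.ic 2 2 3 1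
  have h10 := h.ic 2 5 1 4
  have h11 := h.ic 2 5 1 5
  have h12 := h.ic 0 4 0 2
  have h13 := h.ic 2 3 1 2
  have h14 := h.ic 2 2 3 0
  have h15 := h.ic 3 3 3 2
  have h16 := h.ic 4 5 4 4
  have h17 := h.ic 2 4 2 3
  have h18 := h.ic 0 4 1 3
  have h19 := h.ic 1 4 2 3
  have h20 := h.ic 3 5 2 5
  have h21 := h.ic 3 4 3 5
  have h22 := h.ic 4 5 3 5
  have h23 := h.ic 3 4 2 4
  have h24 := h.ic 4 5 3 4
  have h25 := h.ic 2 5 2 4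
  have h26 := h.ic 5 5 5 4
  have h27 := h.ic 0 5 0 4
  have h28 := h.ic 2 5 0 5
  have h29 := h.ic 1 5 0 4
  have h30 := h.ic 4 5 2 5
  have h31 := h.ic 0 4 2 3
  have h32 := h.ic 2 3 0 2
  have h33 := h.ic 2 5 0 4
  have h34 := h.ic 1 3 0 3
  have h35 := h.ic 3 5 5 4
  have h36 := h.ic 2 4 3 3
  have h37 := h.ic 0 4 3 0
  have h38 := h.ic 0 4 0 3
  simp only [value_zero, value_one, value_two, value_three, value_four, value_five,
    h.symm 1 0, h.symm 2 0, h.symm 2 1,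
    h.symm 3 0, h.symm 3 1, h.symm 3 2, h.symm 4 0, h.symm 4 1, h.symm 4 2, h.symm 4 3,
    h.symm 5 0, h.symm 5 1, h.symm 5 2, h.symm 5 3, h.symm 5 4]
    at
      h1 h2 h3 h4 h5 h6 h7 h8 h9 h10 h11 h12 h13 h14 h15 h16 h17 h18 h19 h20 h21 h22 h23 h24 h25
      h26 h27 h28 h29 h30 h31 h32 h33 h34 h35 h36 h37 h38 ⊢
  linear_combination
    5755201 / 295650000 * h1 + 2399 / 145800000 * h2 + 833 / 405000 * h3 + 23 / 2025 * h4 +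
    119 / 297 * h5 + 49 / 100 * h6 + 2399 / 763171875 * h7 + 13 / 1336500000 * h8 +
    301 / 81000 * h.lb 1 2 + 19 / 488700 * h9 + 7 / 33750 * h10 + 91 / 6682500 * h11 +
    1974377 / 247860000 * h12 + 23 / 202500 * h13 + 466 / 40725 * h14 +
    58531241 / 129532500 * h15 + 1290550711 / 213728625 * h.ub 4 0 + 98 / 225 * h16 +
    10358923 / 1424857500 * h17 + 391 / 3665250 * h18 + 469 / 202500 * h19 +
    1013380057 / 7836716250 * h20 + 28 / 81 * h.ub 5 2 + 59068574 / 118738125 * h21 +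
    658 / 4455 * h22 + 124154080453721 / 8763728539500000 * h.ir 0 4 + 161 / 675 * h23 +
    329 / 1485 * h24 + 14 / 675 * h25 + 49 / 2025 * h26 + 16793 / 2025 * h.ub 5 0 +
    386239 / 3645000 * h27 + 16793 / 729000 * h28 + 1447637888 / 71242875 * h.ub 5 3 +
    673807232993 / 23510148750 * h.ub 5 4 + 392 / 81 * h.ub 5 5 +
    178411231 / 1971000000 * h.ir 0 0 + 256693 / 3256200000 * h.ir 0 1 +
    256693 / 16524000 * h.ir 0 2 + 21569 / 44550 * h.ir 0 3 + 161 / 3341250 * h29 +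
    7 / 2025 * h.ub 5 1 + 59 / 2673000000 * h.ir 1 1 + 155087 / 1336500000 * h.ir 1 2 +
    41074337 / 47020297500 * h30 + 37451 / 38859750 * h31 + 2399 / 1458000 * h32 +
    6897471839 / 76942305000 * h33 + 98231541744893 / 224671530600000 * h.ir 2 3 +
    161 / 733050 * h34 + 5146066231 / 23510148750 * h35 + 366436727 / 1424857500 * h36 +
    14886178 / 356214375 * hf + 307 / 15750 * h37 + 314011483 / 158317500 * h.lb 0 4 +
    2223393638 / 2351014875 * h.ub 4 5 + 31077929 / 112889700 * h38

/-! ### From the probability distribution to a sum over 36 types. -/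

theorem value_injective : Function.Injective value := by
  intro i j h
  fin_cases i <;> fin_cases j <;> first | rfl | (exfalso; norm_num [value] at h)

theorem exists_value_eq_iff (x : ℝ) :
    (∃ i, value i = x) ↔ x ∈ ({10, 13, 46, 47, 80, 100} : Finset ℝ) := by
  simp only [Fin.exists_fin_succ, Finset.mem_insert, Finset.mem_singleton]
  simp [value, eq_comm]

theorem hartReny_value (i : Fin 6) : hartReny (value i) = ENNReal.ofReal (weight i) := by
  have h : hartReny (value i) = hartRenyMass (value i) := rfl
  rw [h, hartRenyMass]
  congr 1
  fin_cases i <;> norm_num [value, weight]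

theorem weight_pos (i : Fin 6) : 0 < weight i := by
  fin_cases i <;> norm_num [weight]

theorem value_nonneg (i : Fin 6) : 0 ≤ value i := by
  fin_cases i <;> norm_num [value]

theorem value_le (i : Fin 6) : value i ≤ 100 := by
  fin_cases i <;> norm_num [value]

theorem hartReny_ne_zero_iff (x : ℝ) : hartReny x ≠ 0 ↔ ∃ i, value i = x := by
  constructor
  · intro h
    rw [exists_value_eq_iff]
    by_contra hx
    exact h (hartRenyMass_eq_zero x hx)
  · rintro ⟨i, rfl⟩
    rw [hartReny_value]
    simpa using weight_pos i

theorem hartReny_support_finite : hartReny.support.Finite := by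
  refine (Set.finite_range value).subset fun x hx => ?_
  exact (hartReny_ne_zero_iff x).1 ((PMF.mem_support_iff _ _).1 hx)

theorem iidPair_apply (F : PMF ℝ) (v : Valuation) : iidPair F v = F (v 0) * F (v 1) := by
  rw [iidPair, PMF.bind_apply, tsum_eq_single (v 0)]
  · rw [PMF.bind_apply, tsum_eq_single (v 1)]
    · have h : v = ![v 0, v 1] := by ext i; fin_cases i <;> rfl
      rw [PMF.pure_apply, if_pos h, mul_one]
    · intro b hb
      rw [PMF.pure_apply, if_neg, mul_zero]
      rintro h
      exact hb (congrFun h 1).symm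
  · intro a ha
    rw [PMF.bind_apply, mul_eq_zero]
    right
    rw [ENNReal.tsum_eq_zero]
    intro b
    rw [PMF.pure_apply, if_neg, mul_zero]
    rintro h
    exact ha (congrFun h 0).symm

/-- The buyer types in the support of the distribution. -/
abbrev BuyerType : Type := Fin 6 × Fin 6

/-- The valuation of a buyer type. -/
def valuation (t : BuyerType) : Valuation := ![value t.1, value t.2]

/-- The probability of a buyer type. -/
def probability (t : BuyerType) : ℝ := weight t.1 * weight t.2

theorem probability_pos (t : BuyerType) : 0 < probability t :=
  mul_pos (weight_pos _) (weight_pos _)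

theorem valuation_nonneg (t : BuyerType) (i : Fin 2) : 0 ≤ valuation t i := by
  fin_cases i <;> exact value_nonneg _

theorem valuation_le (t : BuyerType) (i : Fin 2) : valuation t i ≤ 100 := by
  fin_cases i <;> exact value_le _

theorem valuation_injective : Function.Injective valuation := fun _ _ h =>
  Prod.ext (value_injective (congrFun h 0)) (value_injective (congrFun h 1))

theorem iidPair_hartReny_valuation (t : BuyerType) :
    (iidPair hartReny (valuation t)).toReal = probability t := by
  rw [iidPair_apply]
  change (hartReny (value t.1) * hartReny (value t.2)).toReal = _
  rw [hartReny_value, hartReny_value, ENNReal.toReal_mul,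
    ENNReal.toReal_ofReal (weight_pos _).le, ENNReal.toReal_ofReal (weight_pos _).le, probability]

theorem mem_support_iff (v : Valuation) :
    v ∈ (iidPair hartReny).support ↔ ∃ t, valuation t = v := by
  rw [PMF.mem_support_iff, iidPair_apply, mul_ne_zero_iff, hartReny_ne_zero_iff,
    hartReny_ne_zero_iff]
  constructor
  · rintro ⟨⟨i, hi⟩, ⟨j, hj⟩⟩
    refine ⟨(i, j), ?_⟩
    ext k
    fin_cases k
    · exact hi
    · exact hj
  · rintro ⟨t, rfl⟩
    exact ⟨⟨t.1, rfl⟩, ⟨t.2, rfl⟩⟩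

theorem tsum_iidPair_hartReny (g : Valuation → ℝ) :
    ∑' v, (iidPair hartReny v).toReal * g v = ∑ t, probability t * g (valuation t) := by
  classical
  rw [tsum_eq_sum (s := Finset.univ.image valuation), Finset.sum_image]
  · exact Finset.sum_congr rfl fun t _ => by rw [iidPair_hartReny_valuation]
  · exact fun _ _ _ _ h => valuation_injective h
  · intro v hv
    have h : v ∉ (iidPair hartReny).support := by
      rw [mem_support_iff]
      simpa using hv
    rw [PMF.mem_support_iff, not_not] at h
    rw [h, ENNReal.toReal_zero, zero_mul]

/-- Choices off the support are unconstrained and carry no mass, so only the 36 types matter. -/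
theorem hasRevenue_iff (model : BuyerModel) (M : Menu) (r : ℝ) :
    HasRevenue (iidPair hartReny) model M r ↔ ∃ c : BuyerType → Multiset Entry,
      (∀ t, IsBuyerChoice (model M) (valuation t) (c t)) ∧
        r = ∑ t, probability t * payment (c t) := by
  constructor
  · rintro ⟨choice, hc, rfl⟩
    exact ⟨fun t => choice (valuation t), fun t => hc _ ((mem_support_iff _).2 ⟨t, rfl⟩),
      tsum_iidPair_hartReny fun v => payment (choice v)⟩
  · rintro ⟨c, hc, rfl⟩
    have h : ∀ t, Function.extend valuation c (fun _ => 0) (valuation t) = c t :=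
      fun t => valuation_injective.extend_apply _ _ _
    refine ⟨Function.extend valuation c fun _ => 0, fun v hv => ?_, ?_⟩
    · obtain ⟨t, rfl⟩ := (mem_support_iff v).1 hv
      rw [h]
      exact hc t
    · rw [tsum_iidPair_hartReny fun v => payment (Function.extend valuation c (fun _ => 0) v)]
      simp only [h]

/-! ### Tie-breaking and the algebra of independent lotteries. -/

/-- A maximizer of the utility can be replaced by one of maximal payment if the maximizers have
only finitely many payments. -/
theorem exists_isBuyerChoice {A : Set (Multiset Entry)} {v : Valuation} {B : Multiset Entry}
    (hB : B ∈ A) (hmax : ∀ B' ∈ A, utility v B' ≤ utility v B)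
    (hfin : (payment '' {B' ∈ A | utility v B' = utility v B}).Finite) :
    ∃ C, IsBuyerChoice A v C ∧ payment B ≤ payment C := by
  obtain ⟨p, ⟨⟨C, ⟨hCA, hCu⟩, rfl⟩, hp⟩⟩ :=
    hfin.exists_maximal ⟨payment B, B, ⟨hB, rfl⟩, rfl⟩
  have hle : ∀ B' ∈ A, utility v B' = utility v B → payment B' ≤ payment C := fun B' h h' =>
    (le_total (payment B') (payment C)).elim id fun hc => hp ⟨B', ⟨h, h'⟩, rfl⟩ hc
  exact ⟨C, ⟨hCA, fun B' h => hCu ▸ hmax B' h, fun B' h h' => hle B' h (h'.trans hCu)⟩,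
    hle B hB rfl⟩

theorem prod_one_sub_alloc_mem (B : Multiset Entry) (i : Fin 2) :
    (B.map fun e => 1 - e.alloc i).prod ∈ Set.Icc (0 : ℝ) 1 := by
  induction B using Multiset.induction_on with
  | empty => simp
  | cons e B ih =>
    rw [Multiset.map_cons, Multiset.prod_cons]
    have he := e.alloc_mem i
    exact ⟨mul_nonneg (by linarith [he.2]) ih.1,
      mul_le_one₀ (by linarith [he.1]) ih.1 ih.2⟩

theorem winProb_mem (B : Multiset Entry) (i : Fin 2) : winProb B i ∈ Set.Icc (0 : ℝ) 1 := by
  have h := prod_one_sub_alloc_mem B i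
  exact ⟨by unfold winProb; linarith [h.2], by unfold winProb; linarith [h.1]⟩

theorem utility_eq (v : Valuation) (B : Multiset Entry) :
    utility v B = v 0 * winProb B 0 + v 1 * winProb B 1 - payment B := by
  rw [utility, Fin.sum_univ_two]

@[simp]
theorem winProb_zero (i : Fin 2) : winProb 0 i = 0 := by simp [winProb]

@[simp]
theorem payment_zero : payment 0 = 0 := by simp [payment]

@[simp]
theorem utility_zero (v : Valuation) : utility v 0 = 0 := by simp [utility]

@[simp]
theorem winProb_singleton (e : Entry) (i : Fin 2) : winProb {e} i = e.alloc i := by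
  simp [winProb]

@[simp]
theorem payment_singleton (e : Entry) : payment {e} = e.price := by simp [payment]

theorem one_sub_winProb_add (B C : Multiset Entry) (i : Fin 2) :
    1 - winProb (B + C) i = (1 - winProb B i) * (1 - winProb C i) := by
  simp [winProb]

theorem payment_add (B C : Multiset Entry) : payment (B + C) = payment B + payment C := by
  simp [payment]

/-! ### Symmetrization of the buyer's choices. -/

/-- The average over both items of the probability that the item of value `value i` is won. -/
def symmetricAlloc (c : BuyerType → Multiset Entry) (i j : Fin 6) : ℝ :=
  (winProb (c (i, j)) 0 + winProb (c (j, i)) 1) / 2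

/-- The average utility of the types `(i, j)` and `(j, i)`. -/
def symmetricUtility (c : BuyerType → Multiset Entry) (i j : Fin 6) : ℝ :=
  (utility (valuation (i, j)) (c (i, j)) + utility (valuation (j, i)) (c (j, i))) / 2

theorem utility_valuation (i j : Fin 6) (B : Multiset Entry) :
    utility (valuation (i, j)) B = value i * winProb B 0 + value j * winProb B 1 - payment B :=
  utility_eq _ _

/-- Each constraint is the average of two: the one for a type and the one for its mirror image.
Incentive compatibility only needs that a type may imitate the choice of another. -/
theorem symmetricMechanism {A : Set (Multiset Entry)} (h0 : 0 ∈ A)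
    {c : BuyerType → Multiset Entry} (hc : ∀ t, IsBuyerChoice A (valuation t) (c t)) :
    SymmetricMechanism (symmetricAlloc c) (symmetricUtility c) where
  lb i j := by
    have h := (winProb_mem (c (i, j)) 0).1
    have h' := (winProb_mem (c (j, i)) 1).1
    unfold symmetricAlloc
    linarith
  ub i j := by
    have h := (winProb_mem (c (i, j)) 0).2
    have h' := (winProb_mem (c (j, i)) 1).2
    unfold symmetricAlloc
    linarith
  ir i j := by
    have h := (hc (i, j)).2.1 0 h0
    have h' := (hc (j, i)).2.1 0 h0
    rw [utility_zero] at h h'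
    unfold symmetricUtility
    linarith
  symm i j := by
    unfold symmetricUtility
    ring
  ic i j k l := by
    have h := (hc (i, j)).2.1 _ (hc (k, l)).1
    have h' := (hc (j, i)).2.1 _ (hc (l, k)).1
    simp only [symmetricUtility, symmetricAlloc, utility_valuation] at h h' ⊢
    linarith

/-- The values are IID, so mirror types are equally likely and averaging their payments preserves
the revenue. -/
theorem sum_probability_mul_payment (c : BuyerType → Multiset Entry) :
    ∑ t, probability t * payment (c t) =
      symmetricRevenue (symmetricAlloc c) (symmetricUtility c) := by
  have h : ∑ t : BuyerType, probability t * payment (c t) =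
      ∑ i, ∑ j, weight i * weight j * payment (c (i, j)) := Fintype.sum_prod_type _
  have h' : ∑ i, ∑ j, weight i * weight j * payment (c (i, j)) =
      ∑ i, ∑ j, weight i * weight j * payment (c (j, i)) := by
    rw [Finset.sum_comm]
    simp only [mul_comm]
  have h2 : ∑ i, ∑ j, weight i * weight j * payment (c (i, j)) =
      ∑ i, ∑ j, weight i * weight j * ((payment (c (i, j)) + payment (c (j, i))) / 2) := by
    simp only [add_div, mul_add, Finset.sum_add_distrib, mul_div_assoc', ← Finset.sum_div]
    rw [← h']
    ring
  rw [h, h2, symmetricRevenue]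
  refine Finset.sum_congr rfl fun i _ => Finset.sum_congr rfl fun j _ => ?_
  simp only [symmetricUtility, symmetricAlloc, utility_valuation]
  ring

theorem revenue_le_optimalRevenue {A : Set (Multiset Entry)} (h0 : 0 ∈ A)
    {c : BuyerType → Multiset Entry} (hc : ∀ t, IsBuyerChoice A (valuation t) (c t)) :
    ∑ t, probability t * payment (c t) ≤ optimalRevenue := by
  rw [sum_probability_mul_payment]
  exact (symmetricMechanism h0 hc).revenue_le

/-- If every choice may be picked twice, then the revenue is bounded away from optimal: the types
of values 47 and 80 could pick the choice of the type of values 47 and 47 twice. -/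
theorem revenue_lt_optimalRevenue {A : Set (Multiset Entry)} (h0 : 0 ∈ A)
    (hadd : ∀ B ∈ A, B + B ∈ A) {c : BuyerType → Multiset Entry}
    (hc : ∀ t, IsBuyerChoice A (valuation t) (c t)) :
    ∑ t, probability t * payment (c t) < optimalRevenue := by
  rw [sum_probability_mul_payment]
  have h := symmetricMechanism h0 hc
  -- The threshold is large enough for the bonus bound to fall below the optimum, and small enough
  -- to control the quadratic loss in the other case.
  rcases le_total (1 / 20) (symmetricAlloc c 3 3) with hA | hA
  · have := h.revenue_add_le
    unfold optimalRevenue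
    linarith
  · refine (h.revenue_le_of_utility_gap ?_).trans_lt (by norm_num [optimalRevenue])
    -- Both mirror types (47, 80) and (80, 47) deviate to two copies of the choice of (47, 47).
    have h1 := (hc (3, 4)).2.1 _ (hadd _ (hc (3, 3)).1)
    have h2 := (hc (4, 3)).2.1 _ (hadd _ (hc (3, 3)).1)
    have e0 := one_sub_winProb_add (c (3, 3)) (c (3, 3)) 0
    have e1 := one_sub_winProb_add (c (3, 3)) (c (3, 3)) 1
    have p0 := (winProb_mem (c (3, 3)) 0).1
    have p1 := (winProb_mem (c (3, 3)) 1).1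
    simp only [symmetricUtility, symmetricAlloc, utility_valuation, payment_add, value_three,
      value_four] at h1 h2 hA ⊢
    generalize winProb (c (3, 3)) 0 = a at *
    generalize winProb (c (3, 3)) 1 = b at *
    -- Averaged, doubling yields `2 * U 3 3 + 33 * (a + b) - 63.5 * (a ^ 2 + b ^ 2)`. Since `a + b ≤
    -- 1 / 10`, the loss is at most `6.35 * (a + b)`, which leaves more than the required `26.5 * (a
    -- + b)`, that is, 53 times the average of `a` and `b`.
    nlinarith [mul_nonneg p0 p1, mul_nonneg (add_nonneg p0 p1) (sub_nonneg.2 hA)]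

/-! ### An optimal finite menu for a single pick. -/

theorem singlePick_finite {M : Menu} (hM : M.Finite) : (singlePick M).Finite := by
  refine ((hM.image fun e => ({e} : Multiset Entry)).insert 0).subset ?_
  rintro B ⟨hcard, hB⟩
  rcases Nat.le_one_iff_eq_zero_or_eq_one.1 hcard with h | h
  · exact Or.inl (Multiset.card_eq_zero.1 h)
  · obtain ⟨e, rfl⟩ := Multiset.card_eq_one.1 h
    exact Or.inr ⟨e, hB e (Multiset.mem_singleton_self e), rfl⟩

theorem zero_mem_singlePick (M : Menu) : 0 ∈ singlePick M := by simp [singlePick]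

theorem singleton_mem_singlePick {M : Menu} {e : Entry} (he : e ∈ M) : {e} ∈ singlePick M := by
  simpa [singlePick] using he

theorem optimalRevenue_mem_upperBounds :
    optimalRevenue ∈ upperBounds {x | ∃ M, HasRevenue (iidPair hartReny) singlePick M x} := by
  rintro r ⟨M, hr⟩
  obtain ⟨c, hc, rfl⟩ := (hasRevenue_iff _ _ _).1 hr
  exact revenue_le_optimalRevenue (zero_mem_singlePick M) hc

/-- The allocation probabilities of an optimal menu, multiplied by 65285. -/
def allocNumerator : Fin 11 → Fin 2 → ℕ :=
  ![![0, 0], ![0, 65285], ![65285, 0], ![1760, 62117], ![62117, 1760], ![1925, 62117],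
    ![62117, 1925], ![1760, 1920], ![1920, 1760], ![1925, 1925], ![65285, 65285]]

/-- The prices of an optimal menu, multiplied by 65285. -/
def priceNumerator : Fin 11 → ℕ :=
  ![0, 5222800, 5222800, 4986960, 4986960, 4994550, 4994550, 171200, 171200, 179190, 8225910]

/-- The values in the support of the Hart–Reny distribution, as natural numbers. -/
def natValue : Fin 6 → ℕ := ![10, 13, 46, 47, 80, 100]

/-- The entry of the optimal menu assigned to each type. -/
def assignment : Fin 6 → Fin 6 → Fin 11 :=
  ![![0, 0, 0, 0, 1, 1], ![0, 0, 0, 0, 3, 1], ![0, 0, 0, 7, 5, 10], ![0, 0, 8, 9, 10, 10],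
    ![2, 4, 6, 10, 10, 10], ![2, 2, 10, 10, 10, 10]]

theorem allocNumerator_le : ∀ k i, allocNumerator k i ≤ 65285 := by decide

/-- Denominators are cleared and prices moved across the inequality, so that incentive compatibility
is a finite check in `ℕ` without subtraction. -/
theorem assignment_incentive : ∀ i j k,
    natValue i * allocNumerator k 0 + natValue j * allocNumerator k 1 +
        priceNumerator (assignment i j) ≤
      natValue i * allocNumerator (assignment i j) 0 +
        natValue j * allocNumerator (assignment i j) 1 + priceNumerator k := by
  decide +kernel

theorem cast_natValue (i : Fin 6) : (natValue i : ℝ) = value i := by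
  fin_cases i <;> norm_num [natValue, value]

/-- The entries of an optimal menu. -/
def optimalEntry (k : Fin 11) : Entry where
  alloc i := allocNumerator k i / 65285
  price := priceNumerator k / 65285
  alloc_mem i := by
    have h : (allocNumerator k i : ℝ) ≤ 65285 := mod_cast allocNumerator_le k i
    exact ⟨by positivity, div_le_one_of_le₀ h (by norm_num)⟩

theorem utility_optimalEntry_le (t : BuyerType) (k : Fin 11) :
    utility (valuation t) {optimalEntry k} ≤
      utility (valuation t) {optimalEntry (assignment t.1 t.2)} := by
  have h : (natValue t.1 * allocNumerator k 0 + natValue t.2 * allocNumerator k 1 +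
        priceNumerator (assignment t.1 t.2) : ℝ) ≤
      natValue t.1 * allocNumerator (assignment t.1 t.2) 0 +
        natValue t.2 * allocNumerator (assignment t.1 t.2) 1 + priceNumerator k :=
    mod_cast assignment_incentive t.1 t.2 k
  rw [cast_natValue, cast_natValue] at h
  rw [utility_valuation, utility_valuation]
  simp only [winProb_singleton, payment_singleton, optimalEntry]
  linarith

theorem utility_zero_optimalEntry (v : Valuation) : utility v {optimalEntry 0} = 0 := by
  rw [utility_eq]
  simp [optimalEntry, allocNumerator, priceNumerator]

/-- The probabilities of the values, multiplied by 9000. -/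
def natWeight : Fin 6 → ℕ := ![2399, 1, 100, 3000, 2100, 1400]

theorem natWeight_div (i : Fin 6) : (natWeight i : ℝ) / 9000 = weight i := by
  fin_cases i <;> norm_num [natWeight, weight]

theorem sum_natWeight_mul_priceNumerator :
    ∑ i, ∑ j, natWeight i * natWeight j * priceNumerator (assignment i j) = 367369952772000 := by
  decide +kernel

theorem sum_probability_mul_price :
    ∑ t : BuyerType, probability t * payment {optimalEntry (assignment t.1 t.2)} =
      optimalRevenue := by
  have h : ∀ t : BuyerType, probability t * payment {optimalEntry (assignment t.1 t.2)} =
      (natWeight t.1 * natWeight t.2 * priceNumerator (assignment t.1 t.2) : ℕ) /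
        (9000 ^ 2 * 65285) := fun t => by
    rw [payment_singleton, probability, ← natWeight_div, ← natWeight_div]
    simp only [optimalEntry]
    push_cast
    ring
  rw [Finset.sum_congr rfl fun t _ => h t, ← Finset.sum_div, ← Nat.cast_sum,
    Fintype.sum_prod_type, sum_natWeight_mul_priceNumerator, optimalRevenue]
  norm_num

theorem exists_finite_hasRevenue :
    ∃ M : Menu, M.Finite ∧ HasRevenue (iidPair hartReny) singlePick M optimalRevenue := by
  have hfin : (Set.range optimalEntry).Finite := Set.finite_range _
  refine ⟨Set.range optimalEntry, hfin, (hasRevenue_iff _ _ _).2 ?_⟩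
  have hex : ∀ t : BuyerType, ∃ C,
      IsBuyerChoice (singlePick (Set.range optimalEntry)) (valuation t) C ∧
        payment {optimalEntry (assignment t.1 t.2)} ≤ payment C := fun t => by
    refine exists_isBuyerChoice (singleton_mem_singlePick ⟨_, rfl⟩) ?_
      (((singlePick_finite hfin).subset fun B hB => hB.1).image _)
    rintro B ⟨hcard, hB⟩
    rcases Nat.le_one_iff_eq_zero_or_eq_one.1 hcard with h | h
    -- Entry 0 is the free null lottery, so participation is a case of incentive compatibility.
    · rw [Multiset.card_eq_zero.1 h, utility_zero, ← utility_zero_optimalEntry (valuation t)]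
      exact utility_optimalEntry_le t 0
    · obtain ⟨e, rfl⟩ := Multiset.card_eq_one.1 h
      obtain ⟨k, rfl⟩ := hB e (Multiset.mem_singleton_self e)
      exact utility_optimalEntry_le t k
  choose c hc hpay using hex
  -- Tie-breaking can only raise payments above those of `assignment`; the upper bound then forces
  -- equality.
  refine ⟨c, hc, le_antisymm ?_ (revenue_le_optimalRevenue (zero_mem_singlePick _) hc)⟩
  rw [← sum_probability_mul_price]
  exact Finset.sum_le_sum fun t _ => mul_le_mul_of_nonneg_left (hpay t) (probability_pos t).le

/-! ### The non-adaptive buyer: unions of picks and bounds on payments. -/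

theorem zero_mem_nonAdaptivePicks (M : Menu) : 0 ∈ nonAdaptivePicks M := by
  simp [nonAdaptivePicks]

theorem add_mem_nonAdaptivePicks {M : Menu} {B C : Multiset Entry} (hB : B ∈ nonAdaptivePicks M)
    (hC : C ∈ nonAdaptivePicks M) : B + C ∈ nonAdaptivePicks M := fun e he =>
  (Multiset.mem_add.1 he).elim (hB e) (hC e)

theorem nsmul_mem_nonAdaptivePicks {M : Menu} {B : Multiset Entry} (hB : B ∈ nonAdaptivePicks M)
    (n : ℕ) : n • B ∈ nonAdaptivePicks M := by
  induction n with
  | zero => simpa using zero_mem_nonAdaptivePicks M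
  | succ n ih => rw [succ_nsmul]; exact add_mem_nonAdaptivePicks ih hB

theorem sum_map_mem_nonAdaptivePicks {M : Menu} {c : BuyerType → Multiset Entry}
    (hc : ∀ t, c t ∈ nonAdaptivePicks M) (S : Multiset BuyerType) :
    (S.map c).sum ∈ nonAdaptivePicks M := by
  induction S using Multiset.induction_on with
  | empty => simpa using zero_mem_nonAdaptivePicks M
  | cons t S ih =>
    rw [Multiset.map_cons, Multiset.sum_cons]
    exact add_mem_nonAdaptivePicks (hc t) ih

theorem payment_nsmul (n : ℕ) (B : Multiset Entry) : payment (n • B) = n * payment B := by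
  simp [payment, Multiset.map_nsmul, Multiset.sum_nsmul]

theorem payment_sum_map (c : BuyerType → Multiset Entry) (S : Multiset BuyerType) :
    payment (S.map c).sum = (S.map fun t => payment (c t)).sum := by
  induction S using Multiset.induction_on with
  | empty => simp
  | cons t S ih => simp [payment_add, ih]

theorem one_sub_winProb_sum_map (c : BuyerType → Multiset Entry) (S : Multiset BuyerType)
    (i : Fin 2) :
    1 - winProb (S.map c).sum i = (S.map fun t => 1 - winProb (c t) i).prod := by
  induction S using Multiset.induction_on with
  | empty => simp
  | cons t S ih =>
    rw [Multiset.map_cons, Multiset.sum_cons, one_sub_winProb_add, ih, Multiset.map_cons,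
      Multiset.prod_cons]

theorem utility_le (t : BuyerType) (B : Multiset Entry) :
    utility (valuation t) B ≤ 200 - payment B := by
  have h : ∀ i, valuation t i * winProb B i ≤ 100 := fun i =>
    (mul_le_of_le_one_right (valuation_nonneg t i) (winProb_mem B i).2).trans (valuation_le t i)
  rw [utility_eq]
  linarith [h 0, h 1]

theorem neg_payment_le_utility (t : BuyerType) (B : Multiset Entry) :
    -payment B ≤ utility (valuation t) B := by
  have h : ∀ i, 0 ≤ valuation t i * winProb B i := fun i =>
    mul_nonneg (valuation_nonneg t i) (winProb_mem B i).1
  rw [utility_eq]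
  linarith [h 0, h 1]

theorem payment_le_of_utility_nonneg {t : BuyerType} {B : Multiset Entry}
    (h : 0 ≤ utility (valuation t) B) : payment B ≤ 200 := by
  linarith [utility_le t B]

/-- No collection of entries has a negative price if some type has a utility bound: copies of it
would be a money pump. -/
theorem payment_nonneg_of_utility_le {M : Menu} {t : BuyerType} {u : ℝ}
    (hu : ∀ B ∈ nonAdaptivePicks M, utility (valuation t) B ≤ u) {B : Multiset Entry}
    (hB : B ∈ nonAdaptivePicks M) : 0 ≤ payment B := by
  by_contra! h
  -- With so many copies, the money received alone exceeds the utility bound.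
  obtain ⟨n, hn⟩ := exists_nat_gt (u / -payment B)
  rw [div_lt_iff₀ (by linarith)] at hn
  have h1 := neg_payment_le_utility t (n • B)
  have h2 := hu _ (nsmul_mem_nonAdaptivePicks hB n)
  rw [payment_nsmul] at h1
  linarith

/-! ### Existence of an optimal menu for the non-adaptive buyer, by compactness. -/

/-- The outcomes of a direct mechanism: an allocation and a payment for every type. -/
abbrev Outcomes : Type := (BuyerType → Fin 2 → ℝ) × (BuyerType → ℝ)

/-- The utility of type `t` when she plays the lotteries of the types in `S` independently. -/
def outcomeUtility (x : Outcomes) (t : BuyerType) (S : Multiset BuyerType) : ℝ :=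
  (∑ i, valuation t i * (1 - (S.map fun w => 1 - x.1 w i).prod)) - (S.map fun w => x.2 w).sum

/-- The direct mechanisms in which no type gains from several reports. -/
def falseNameProof : Set Outcomes :=
  {x | (∀ t i, x.1 t i ∈ Set.Icc 0 1) ∧ (∀ t, x.2 t ∈ Set.Icc 0 200) ∧
    ∀ t S, outcomeUtility x t S ≤ outcomeUtility x t {t}}

theorem continuous_outcomeUtility (t : BuyerType) (S : Multiset BuyerType) :
    Continuous fun x => outcomeUtility x t S := by
  refine Continuous.sub (continuous_finsetSum _ fun i _ => continuous_const.mul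
    (continuous_const.sub (continuous_multiset_prod _ fun w _ => ?_)))
    (continuous_multiset_sum _ fun w _ => ?_)
  · fun_prop
  · fun_prop

/-- For each fixed multiset of reports the constraint is a polynomial inequality, hence closed;
infinitely many of them still cut out a closed subset of a compact box. -/
theorem isCompact_falseNameProof : IsCompact falseNameProof := by
  have hK : IsCompact ((Set.univ.pi fun _ : BuyerType => Set.univ.pi fun _ : Fin 2 =>
      Set.Icc (0 : ℝ) 1) ×ˢ (Set.univ.pi fun _ : BuyerType => Set.Icc (0 : ℝ) 200)) :=
    (isCompact_univ_pi fun _ => isCompact_univ_pi fun _ => isCompact_Icc).prod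
      (isCompact_univ_pi fun _ => isCompact_Icc)
  have hC : IsClosed {x : Outcomes | ∀ t S, outcomeUtility x t S ≤ outcomeUtility x t {t}} := by
    simp only [Set.ofPred_forall]
    exact isClosed_iInter fun t => isClosed_iInter fun S =>
      isClosed_le (continuous_outcomeUtility t S) (continuous_outcomeUtility t {t})
  convert hK.inter_right hC using 1
  ext x
  exact ⟨fun h => ⟨⟨fun t _ i _ => h.1 t i, fun t _ => h.2.1 t⟩, h.2.2⟩,
    fun h => ⟨fun t i => h.1.1 t trivial i trivial, fun t => h.1.2 t trivial, h.2⟩⟩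

theorem falseNameProof_nonempty : falseNameProof.Nonempty :=
  ⟨0, by simp, by simp, by simp [outcomeUtility]⟩

/-- The revenue of a direct mechanism. -/
def outcomeRevenue (x : Outcomes) : ℝ := ∑ t, probability t * x.2 t

theorem exists_isMaxOn_outcomeRevenue :
    ∃ x ∈ falseNameProof, IsMaxOn outcomeRevenue falseNameProof x := by
  refine isCompact_falseNameProof.exists_isMaxOn falseNameProof_nonempty
    (Continuous.continuousOn ?_)
  unfold outcomeRevenue
  fun_prop

/-- The outcomes of the choices from a menu. -/
def choiceOutcomes (c : BuyerType → Multiset Entry) : Outcomes :=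
  (fun t i => winProb (c t) i, fun t => payment (c t))

theorem outcomeUtility_choiceOutcomes (c : BuyerType → Multiset Entry) (t : BuyerType)
    (S : Multiset BuyerType) :
    outcomeUtility (choiceOutcomes c) t S = utility (valuation t) (S.map c).sum := by
  simp only [outcomeUtility, choiceOutcomes, utility, payment_sum_map, ← one_sub_winProb_sum_map,
    sub_sub_cancel]

/-- A revelation principle: reporting several types amounts to picking the union of their choices,
which the menu already allows. No money pump and voluntary participation confine payments to [0,
200]. -/
theorem choiceOutcomes_mem_falseNameProof {M : Menu} {c : BuyerType → Multiset Entry}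
    (hc : ∀ t, IsBuyerChoice (nonAdaptivePicks M) (valuation t) (c t)) :
    choiceOutcomes c ∈ falseNameProof := by
  refine ⟨fun t i => winProb_mem _ i, fun t => ⟨?_, ?_⟩, fun t S => ?_⟩
  · exact payment_nonneg_of_utility_le (hc t).2.1 (hc t).1
  · refine payment_le_of_utility_nonneg (t := t) ?_
    rw [← utility_zero (valuation t)]
    exact (hc t).2.1 0 (zero_mem_nonAdaptivePicks M)
  · rw [outcomeUtility_choiceOutcomes, outcomeUtility_choiceOutcomes, Multiset.map_singleton,
      Multiset.sum_singleton]
    exact (hc t).2.1 _ (sum_map_mem_nonAdaptivePicks (fun t => (hc t).1) S)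

/-- The menu entry of a type in a direct mechanism. -/
def outcomeEntry {x : Outcomes} (hx : x ∈ falseNameProof) (t : BuyerType) : Entry where
  alloc := x.1 t
  price := x.2 t
  alloc_mem := hx.1 t

theorem exists_map_outcomeEntry {x : Outcomes} (hx : x ∈ falseNameProof) {B : Multiset Entry}
    (hB : B ∈ nonAdaptivePicks (Set.range (outcomeEntry hx))) :
    ∃ S : Multiset BuyerType, S.map (outcomeEntry hx) = B := by
  induction B using Multiset.induction_on with
  | empty => exact ⟨0, rfl⟩
  | cons e B ih =>
    obtain ⟨S, rfl⟩ := ih fun e' he' => hB e' (Multiset.mem_cons_of_mem he')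
    obtain ⟨t, rfl⟩ := hB e (Multiset.mem_cons_self e _)
    exact ⟨t ::ₘ S, Multiset.map_cons _ _ _⟩

theorem utility_map_outcomeEntry {x : Outcomes} (hx : x ∈ falseNameProof) (t : BuyerType)
    (S : Multiset BuyerType) :
    utility (valuation t) (S.map (outcomeEntry hx)) = outcomeUtility x t S := by
  simp only [utility, outcomeUtility, winProb, payment, Multiset.map_map]
  rfl

/-- Nonnegative prices have only finitely many bounded sums with multiplicities. -/
theorem finite_bounded_multiset_sums {ι : Type*} [Fintype ι] (p : ι → ℝ) (hp : ∀ t, 0 ≤ p t)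
    (b : ℝ) : {y | ∃ S : Multiset ι, (S.map p).sum = y ∧ y ≤ b}.Finite := by
  classical
  -- A positive price `p t` can occur at most `b / p t` times. Free entries may be repeated without
  -- bound but do not change the sum, so their multiplicity is reset to zero below.
  obtain ⟨N, hN⟩ : ∃ N : ι → ℕ, ∀ t, 0 < p t → b / p t ≤ N t :=
    ⟨fun t => ⌈b / p t⌉₊, fun t _ => Nat.le_ceil _⟩
  refine ((Set.finite_Iic N).image fun n => ∑ t, (n t : ℝ) * p t).subset ?_
  rintro _ ⟨S, rfl, hS⟩
  have hsum : (S.map p).sum = ∑ t, (S.count t : ℝ) * p t := by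
    rw [Finset.sum_multiset_map_count]
    simp only [nsmul_eq_mul]
    refine Finset.sum_subset (Finset.subset_univ _) fun t _ ht => ?_
    rw [Multiset.count_eq_zero_of_notMem (by simpa using ht), Nat.cast_zero, zero_mul]
  refine ⟨fun t => if 0 < p t then S.count t else 0, fun t => ?_, ?_⟩
  · by_cases ht : 0 < p t
    · simp only [if_pos ht]
      have h : (S.count t : ℝ) * p t ≤ b := by
        refine le_trans ?_ hS
        rw [hsum]
        exact Finset.single_le_sum (f := fun t => (S.count t : ℝ) * p t)
          (fun t _ => mul_nonneg (Nat.cast_nonneg _) (hp t)) (Finset.mem_univ t)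
      exact_mod_cast ((le_div_iff₀ ht).2 h).trans (hN t ht)
    · simp only [if_neg ht, zero_le]
  · rw [hsum]
    refine Finset.sum_congr rfl fun t _ => ?_
    by_cases ht : 0 < p t
    · simp only [if_pos ht]
    · simp [le_antisymm (not_lt.1 ht) (hp t)]

/-- A false-name-proof direct mechanism is implemented, with at least the same revenue, by the menu
of its outcomes. -/
theorem exists_isBuyerChoice_outcomeEntry {x : Outcomes} (hx : x ∈ falseNameProof)
    (t : BuyerType) :
    ∃ C, IsBuyerChoice (nonAdaptivePicks (Set.range (outcomeEntry hx))) (valuation t) C ∧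
      x.2 t ≤ payment C := by
  have hmem : {outcomeEntry hx t} ∈ nonAdaptivePicks (Set.range (outcomeEntry hx)) := by
    simp [nonAdaptivePicks]
  have hmax : ∀ B ∈ nonAdaptivePicks (Set.range (outcomeEntry hx)),
      utility (valuation t) B ≤ utility (valuation t) {outcomeEntry hx t} := fun B hB => by
    obtain ⟨S, rfl⟩ := exists_map_outcomeEntry hx hB
    rw [utility_map_outcomeEntry, ← Multiset.map_singleton, utility_map_outcomeEntry]
    exact hx.2.2 t S
  have hfin : (payment '' {B ∈ nonAdaptivePicks (Set.range (outcomeEntry hx)) |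
      utility (valuation t) B = utility (valuation t) {outcomeEntry hx t}}).Finite := by
    -- Infinitely many multisets may be optimal, but their payments are at most 200 and hence finite
    -- in number, so a highest one exists for tie-breaking.
    refine (finite_bounded_multiset_sums x.2 (fun w => (hx.2.1 w).1) 200).subset ?_
    rintro _ ⟨B, ⟨hB, hu⟩, rfl⟩
    obtain ⟨S, rfl⟩ := exists_map_outcomeEntry hx hB
    refine ⟨S, by simp only [payment, Multiset.map_map]; rfl,
      payment_le_of_utility_nonneg (t := t) ?_⟩
    rw [hu, ← utility_zero (valuation t)]
    exact hmax 0 (zero_mem_nonAdaptivePicks _)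
  obtain ⟨C, hC, hpay⟩ := exists_isBuyerChoice hmem hmax hfin
  exact ⟨C, hC, by simpa [outcomeEntry] using hpay⟩

theorem exists_isOptimalRevenue_nonAdaptivePicks :
    ∃ r, IsOptimalRevenue (iidPair hartReny) nonAdaptivePicks r := by
  obtain ⟨x, hx, hmax⟩ := exists_isMaxOn_outcomeRevenue
  have hle : ∀ (M : Menu) (c : BuyerType → Multiset Entry),
      (∀ t, IsBuyerChoice (nonAdaptivePicks M) (valuation t) (c t)) →
        ∑ t, probability t * payment (c t) ≤ outcomeRevenue x := fun M c hc =>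
    hmax (choiceOutcomes_mem_falseNameProof hc)
  -- The menu earns at least the maximum because ties favor higher payments, and no more because its
  -- own outcomes are again false-name-proof.
  refine ⟨outcomeRevenue x, ⟨Set.range (outcomeEntry hx), (hasRevenue_iff _ _ _).2 ?_⟩, ?_⟩
  · choose c hc hpay using exists_isBuyerChoice_outcomeEntry hx
    refine ⟨c, hc, le_antisymm ?_ (hle _ c hc)⟩
    exact Finset.sum_le_sum fun t _ => mul_le_mul_of_nonneg_left (hpay t) (probability_pos t).le
  · rintro r ⟨M, hr⟩
    obtain ⟨c, hc, rfl⟩ := (hasRevenue_iff _ _ _).1 hr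
    exact hle M c hc

end FalseName

end

theorem mainTheorem9 :
    FalseName.hartReny.support.Finite ∧
    ∃ R₁ R₂ : ℝ,
      FalseName.IsOptimalRevenue (FalseName.iidPair FalseName.hartReny)
        FalseName.singlePick R₁ ∧
      (∃ M : FalseName.Menu, M.Finite ∧
        FalseName.HasRevenue (FalseName.iidPair FalseName.hartReny)
          FalseName.singlePick M R₁) ∧
      FalseName.IsOptimalRevenue (FalseName.iidPair FalseName.hartReny)
        FalseName.nonAdaptivePicks R₂ ∧
      R₂ < R₁ := by
  obtain ⟨M, hM, hrev⟩ := FalseName.exists_finite_hasRevenue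
  obtain ⟨R₂, hR₂⟩ := FalseName.exists_isOptimalRevenue_nonAdaptivePicks
  refine ⟨FalseName.hartReny_support_finite, FalseName.optimalRevenue, R₂,
    ⟨⟨M, hrev⟩, FalseName.optimalRevenue_mem_upperBounds⟩, ⟨M, hM, hrev⟩, hR₂, ?_⟩
  -- Since R₂ is attained, the strict bound for one menu suffices; of multiple picking it uses only
  -- that a pick may be doubled.
  obtain ⟨N, hN⟩ := hR₂.1
  obtain ⟨c, hc, rfl⟩ := (FalseName.hasRevenue_iff _ _ _).1 hN
  exact FalseName.revenue_lt_optimalRevenue (FalseName.zero_mem_nonAdaptivePicks N)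
    (fun B hB => FalseName.add_mem_nonAdaptivePicks hB hB) hc
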